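/- **Setting.** Let $x_{k+1}=Ax_k+w_k$, $y_k=Cx_k+v_k$ with $A\in\mathbb R^{n_s\times n_s}$, $C\in\mathbb R^{n_y\times n_s}$ and independent zero-mean Gaussian white noises with covariances $Q\succeq 0$ and $R\succ 0$, where $(C,A)$ is observable and $(A,\sqrt Q)$ is controllable. Let $f(X)=AXA^\top+Q$, let $\bar P$ be the steady-state posterior error covariance of the Kalman filter (the limit of the posterior covariances computed by the Riccati recursion from any initial covariance), and let $|\lambda_{\max}(A)|$ be the largest modulus of an eigenvalue of $A$. Let $\lambda,\lambda_a,\lambda_e\in[0,1]$ be the reception probabilities of the legitimate estimator, of its acknowledgement and of the adversary. *Reference policy.* Let $\tau_i\in[0,1]$, $i\in\mathbb N$, be such that the Markov chain on $\mathbb N$ with transitions $i\mapsto 0$ with probability $\tau_i\lambda\lambda_a$ and $i\mapsto i+1$ with probability $1-\tau_i\lambda\lambda_a$ (the sensor's holding time) has a stationary probability distribution $(\pi_i)_{i\in\mathbb N}$. Put $\omega_s(i,1)=\pi_i\tau_i$ and $\omega_s(i,0)=\pi_i(1-\tau_i)$. *Truncated process.* For $N\in\mathbb N$ consider states $(i,j)\in\{0,\dots,N\}^2$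 (sensor's and adversary's holding time) and commands $a\in\{0,1\}$. With $i^+=\min(i+1,N)$ and $j^+=\min(j+1,N)$, the state $(i,j)$ moves to $(i^+,j^+)$ with probability $1$ if $a=0$; if $a=1$, it moves to $(i^+,j^+)$, $(0,j^+)$, $(i^+,0)$, $(0,0)$ with probabilities $(1-\lambda\lambda_a)(1-\lambda_e)$, $\lambda\lambda_a(1-\lambda_e)$, $(1-\lambda\lambda_a)\lambda_e$, $\lambda\lambda_a\lambda_e$ respectively (probabilities of coinciding targets are added). Write $\mathcal P_{i',j',a,i,j}$ for the probability of moving from $(i',j')$ to $(i,j)$ under the command $a$. *Truncated linear program with horizon $N$ and tolerance $\epsilon_s$.* Minimize $$J_e=\sum_{i\le N,\;j<N,\;a}\rho(i,j,a)\,\mathrm{tr}f^j(\bar P)+\sum_{i\le N}\rho(i,N,1)\sum_{j\ge N}\lambda_e(1-\lambda_e)^{j-N}\,\mathrm{tr}f^j(\bar P)$$ over real $\rho(i,j,a)$ and $\epsilon_{i,a}$ ($0\le i,j\le N$, $a\in\{0,1\}$) subject to * $\sum_a\rho(i,j,a)=\sum_{i',j',a}\rho(i',j',a)\,\mathcal P_{i',j',a,i,j}$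 for all $i,j$; $\ \sum_{i,j,a}\rho(i,j,a)=1$; $\ 0\le\rho(i,j,a)\le 1$; * $\rho(i,j,0)=0$ whenever $i=N$ or $j=N$; * $-\epsilon_{i,a}\le\sum_{j\le N}\rho(i,j,a)-\omega_s(i,a)\le\epsilon_{i,a}$ for $0\le i<N$ and all $a$; * $-\epsilon_{N,a}\le\sum_{j\le N}\rho(N,j,a)-\sum_{i\ge N}\omega_s(i,a)\le\epsilon_{N,a}$ for all $a$; * $\sum_{i\le N,\;a}\epsilon_{i,a}\le\epsilon_s$. The program is called feasible if some $(\rho,\epsilon)$ satisfies all the constraints and has $J_e<\infty$. **Theorem (Feasibility).** Assume $\lambda_a<1$, $0<\lambda_e<1$ and $\lambda_e>1-\dfrac1{|\lambda_{\max}(A)|^2}$ (the last condition being void if $\lambda_{\max}(A)=0$). Then for every stealthy tolerance $\epsilon_s>0$ there is a truncation horizon $N_t\in\mathbb N$ such that the truncated linear program with horizon $N_t$ and tolerance $\epsilon_s$ is feasible. -/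

import Mathlib

open Matrix Filter Topology
open scoped ENNReal

namespace StealthyHacking

noncomputable section

/-! ### The linear system and the local Kalman filter -/

variable {n p m : ℕ}

/-- `(C, A)` is observable: the zero output determines the zero initial state. -/
def IsObservable (C : Matrix (Fin p) (Fin n) ℝ) (A : Matrix (Fin n) (Fin n) ℝ) : Prop :=
  ∀ x : Fin n → ℝ, (∀ k : ℕ, C *ᵥ (A ^ k *ᵥ x) = 0) → x = 0

/-- `(A, B)` is controllable: the ranges of `A ^ k * B` together span the state space. -/
def IsControllable (A : Matrix (Fin n) (Fin n) ℝ) (B : Matrix (Fin n) (Fin m) ℝ) : Prop :=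
  (⨆ k : ℕ, LinearMap.range (A ^ k * B).mulVecLin) = ⊤

open scoped MatrixOrder in
/-- The positive semidefinite square root of a positive semidefinite matrix. -/
def psdSqrt (Q : Matrix (Fin n) (Fin n) ℝ) : Matrix (Fin n) (Fin n) ℝ := CFC.sqrt Q

/-- `|λ_max(A)|`: the largest modulus of a complex eigenvalue of `A`. -/
def maxEigAbs (A : Matrix (Fin n) (Fin n) ℝ) : ℝ :=
  (spectralRadius ℂ (A.map (fun r : ℝ => (r : ℂ)))).toReal

/-- The open-loop covariance map `f(X) = A X Aᵀ + Q`. -/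
def openLoop (A Q X : Matrix (Fin n) (Fin n) ℝ) : Matrix (Fin n) (Fin n) ℝ :=
  A * X * Aᵀ + Q

/-- The measurement update of the Kalman filter: it turns the error covariance `S` of the
one-step prediction into the error covariance of the posterior estimate. -/
def measUpdate (C : Matrix (Fin p) (Fin n) ℝ) (R : Matrix (Fin p) (Fin p) ℝ)
    (S : Matrix (Fin n) (Fin n) ℝ) : Matrix (Fin n) (Fin n) ℝ :=
  S - S * Cᵀ * (C * S * Cᵀ + R)⁻¹ * C * S

/-- The posterior error covariance `P_k^s` of the local Kalman filter at the sensor,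
when the initial state has covariance `S₀`. -/
def posteriorCov (A : Matrix (Fin n) (Fin n) ℝ) (C : Matrix (Fin p) (Fin n) ℝ)
    (Q : Matrix (Fin n) (Fin n) ℝ) (R : Matrix (Fin p) (Fin p) ℝ)
    (S₀ : Matrix (Fin n) (Fin n) ℝ) : ℕ → Matrix (Fin n) (Fin n) ℝ
  | 0 => measUpdate C R S₀
  | k + 1 => measUpdate C R (openLoop A Q (posteriorCov A C Q R S₀ k))

/-- The steady-state posterior error covariance `P̄` of the local Kalman filter. (For observable
`(C, A)`, controllable `(A, √Q)`, positive definite `R` and positive semidefinite `S₀` the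
limit exists.) -/
def steadyCov (A : Matrix (Fin n) (Fin n) ℝ) (C : Matrix (Fin p) (Fin n) ℝ)
    (Q : Matrix (Fin n) (Fin n) ℝ) (R : Matrix (Fin p) (Fin p) ℝ)
    (S₀ : Matrix (Fin n) (Fin n) ℝ) : Matrix (Fin n) (Fin n) ℝ :=
  limUnder atTop (posteriorCov A C Q R S₀)

/-- `tr f^j(P̄)`. -/
def trCov (A Q Pbar : Matrix (Fin n) (Fin n) ℝ) (j : ℕ) : ℝ :=
  ((openLoop A Q)^[j] Pbar).trace

/-! ### The chain of the sensor's holding time before the intrusion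

Here `lam`, `lamA`, `lamE` are the reception probabilities of the legitimate estimator, of the
acknowledgement and of the adversary, and `τ i` is the probability with which the reference
policy transmits when the sensor's holding time is `i`. -/

/-- The transition probabilities of the sensor's holding time under the reference policy. -/
def sensorProb (lam lamA : ℝ) (τ : ℕ → ℝ) (i i' : ℕ) : ℝ :=
  if i' = i + 1 then 1 - τ i * lam * lamA
  else if i' = 0 then τ i * lam * lamA
  else 0

/-- `π` is a stationary probability distribution of the sensor's holding time under the
reference policy. -/
structure IsSensorStationary (lam lamA : ℝ) (τ : ℕ → ℝ) (π : ℕ → ℝ) : Prop where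
  nonneg : ∀ i, 0 ≤ π i
  total : HasSum π 1
  balance : ∀ i', HasSum (fun i => π i * sensorProb lam lamA τ i i') (π i')

/-- `ω_s(i, a)`: the stationary probability, before the intrusion, that the sensor's holding
time is `i` and the next transmission command is `a` (`true` means: transmit). -/
def omegaS (τ : ℕ → ℝ) (π : ℕ → ℝ) (i : ℕ) (a : Bool) : ℝ :=
  if a then π i * τ i else π i * (1 - τ i)

/-! ### The truncated Markov decision process

The states are pairs (sensor's holding time, adversary's holding time), both in `{0, …, N}`,
where `N` stands for all holding times that are at least `N`. -/

/-- `min (i + 1) N`. -/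
def incr {N : ℕ} (i : Fin (N + 1)) : Fin (N + 1) :=
  ⟨min ((i : ℕ) + 1) N, Nat.lt_succ_of_le (min_le_right _ _)⟩

/-- The transition probability of the truncated process from `(i, j)` to `(i', j')` under the
command `a`. -/
def truncProb (lam lamA lamE : ℝ) {N : ℕ} (i j : Fin (N + 1)) (a : Bool)
    (i' j' : Fin (N + 1)) : ℝ :=
  if a then
    (if i' = incr i ∧ j' = incr j then (1 - lam * lamA) * (1 - lamE) else 0)
      + (if i' = 0 ∧ j' = incr j then lam * lamA * (1 - lamE) else 0)
      + (if i' = incr i ∧ j' = 0 then (1 - lam * lamA) * lamE else 0)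
      + (if i' = 0 ∧ j' = 0 then lam * lamA * lamE else 0)
  else
    if i' = incr i ∧ j' = incr j then 1 else 0

/-- `ρ ∈ Ω_N`: `ρ` is an occupation measure of the truncated process. -/
structure IsTruncOccupation (lam lamA lamE : ℝ) {N : ℕ}
    (ρ : Fin (N + 1) → Fin (N + 1) → Bool → ℝ) : Prop where
  balance : ∀ i' j', ∑ a, ρ i' j' a = ∑ i, ∑ j, ∑ a, ρ i j a * truncProb lam lamA lamE i j a i' j'
  total : ∑ i, ∑ j, ∑ a, ρ i j a = 1
  nonneg : ∀ i j a, 0 ≤ ρ i j a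
  le_one : ∀ i j a, ρ i j a ≤ 1

/-- The objective `J_e` of the truncated linear program, as an extended nonnegative number:
`∑_{i ≤ N, j < N, a} ρ(i,j,a) tr f^j(P̄)
  + ∑_{i ≤ N} ρ(i,N,1) ∑_{j ≥ N} λ_e (1 - λ_e)^(j - N) tr f^j(P̄)`.
Here `c j` stands for `tr f^j(P̄) ≥ 0`. -/
def truncCost (lamE : ℝ) (c : ℕ → ℝ) {N : ℕ}
    (ρ : Fin (N + 1) → Fin (N + 1) → Bool → ℝ) : ℝ≥0∞ :=
  (∑ i, ∑ j : Fin (N + 1), ∑ a,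
      if (j : ℕ) < N then ENNReal.ofReal (ρ i j a * c j) else 0)
    + ∑ i, ENNReal.ofReal (ρ i (Fin.last N) true) *
        ∑' k : ℕ, ENNReal.ofReal (lamE * (1 - lamE) ^ k * c (N + k))

/-- `(ρ, ε)` satisfies all the constraints of the truncated linear program with horizon `N` and
stealthy tolerance `epsS`; `ωs` is the stationary state-action law before the intrusion. -/
structure SatisfiesConstraints (lam lamA lamE : ℝ) (ωs : ℕ → Bool → ℝ) (epsS : ℝ) {N : ℕ}
    (ρ : Fin (N + 1) → Fin (N + 1) → Bool → ℝ) (ε : Fin (N + 1) → Bool → ℝ) : Prop where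
  occupation : IsTruncOccupation lam lamA lamE ρ
  boundary : ∀ i j, i = Fin.last N ∨ j = Fin.last N → ρ i j false = 0
  stealth_lower : ∀ (i : Fin (N + 1)) (a : Bool), (i : ℕ) < N →
    -ε i a ≤ (∑ j, ρ i j a) - ωs i a
  stealth_upper : ∀ (i : Fin (N + 1)) (a : Bool), (i : ℕ) < N →
    (∑ j, ρ i j a) - ωs i a ≤ ε i a
  stealth_last_lower : ∀ a : Bool,
    -ε (Fin.last N) a ≤ (∑ j, ρ (Fin.last N) j a) - ∑' k : ℕ, ωs (N + k) a
  stealth_last_upper : ∀ a : Bool,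
    (∑ j, ρ (Fin.last N) j a) - ∑' k : ℕ, ωs (N + k) a ≤ ε (Fin.last N) a
  tolerance : ∑ i, ∑ a, ε i a ≤ epsS

/-- The truncated linear program with horizon `N` is feasible: some point satisfies all its
constraints and has a finite objective. -/
def IsFeasible (lam lamA lamE : ℝ) (ωs : ℕ → Bool → ℝ) (c : ℕ → ℝ) (N : ℕ) (epsS : ℝ) : Prop :=
  ∃ (ρ : Fin (N + 1) → Fin (N + 1) → Bool → ℝ) (ε : Fin (N + 1) → Bool → ℝ),
    SatisfiesConstraints lam lamA lamE ωs epsS ρ ε ∧ truncCost lamE c ρ < ∞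

end

end StealthyHacking

/-!
The feasible point is the stationary occupation measure of an explicit policy: use the reference
policy `τ` in the interior of the truncated state space and always transmit on the boundary `i = N`
or `j = N` (`exists_truncOccupation`). The boundary constraint then holds by construction, and what
remains is that the sensor's marginal is close to `ω_s` for a large horizon, and that the objective
is finite.

*Boundary mass.* Each marginal of the occupation measure is a stationary flow of one holding time
(`IsHoldingFlow`). The masses of the holding times `0, …, N - 1` are nonincreasing, so that the
last of them is at most `1 / N`. At `N` every command is a transmission, so that the fraction
`λ λ_a`, respectively `λ_e`, of the mass at `N` leaves in each step. Hence the boundary masses are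
at most `1 / (λ λ_a N)` and `1 / (λ_e N)` (`IsHoldingFlow.mul_mass_last_le`); here `λ λ_a > 0`
because the reference chain has a stationary law.

*Stealthiness.* Below `N` the marginal `m` of the sensor satisfies the balance equations of `π` up
to an error bounded by the boundary mass. Therefore `θ π - m` with `θ = m 0 / π 0` is nonnegative
and uniformly small (`defect_bounds`). Comparing total masses, once over all levels and once below
a level `K`, forces `θ` to be close to `1`, whence `m` is close to `π` in `ℓ¹` (`sum_abs_sub_le`,
`sum_stealthDeviation_le`). With `N = K ^ 2` all error terms vanish as `K → ∞`
(`tendsto_deviation_bound`).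

*Finite objective.* Gelfand's formula bounds `tr f^j(X)` by a multiple of `(j + 1) r ^ (2 j)` for
every `r > 1` above the spectral radius of `A`. The condition on `λ_e` permits a choice with
`(1 - λ_e) r ^ 2 < 1`, so that the series over the waiting time of the adversary converges
(`summable_geometric_mul_trCov`).
-/

namespace StealthyHacking

/-! ### Stationary laws of finite Markov chains -/

/-- Every finite stochastic matrix has a stationary probability vector. The matrix `P - 1` kills the
all-ones vector, hence has a left null vector `v`; the triangle inequality gives `|v| ≤ |v| P`
entrywise, and both sides have the same total mass. -/
lemma exists_stationary_of_mem_rowStochastic {ι : Type*} [Fintype ι] [DecidableEq ι] [Nonempty ι]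
    {P : Matrix ι ι ℝ} (hP : P ∈ rowStochastic ℝ ι) :
    ∃ v : ι → ℝ, (∀ i, 0 ≤ v i) ∧ ∑ i, v i = 1 ∧ v ᵥ* P = v := by
  have hdet : (P - 1).det = 0 := by
    rw [← Matrix.exists_mulVec_eq_zero_iff]
    refine ⟨1, one_ne_zero, ?_⟩
    rw [Matrix.sub_mulVec, one_vecMul_of_mem_rowStochastic hP, Matrix.one_mulVec, sub_self]
  obtain ⟨v, hv0, hv⟩ := Matrix.exists_vecMul_eq_zero_iff.mpr hdet
  rw [Matrix.vecMul_sub, Matrix.vecMul_one, sub_eq_zero] at hv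
  have hle : ∀ j, |v j| ≤ ∑ i, |v i| * P i j := fun j ↦ by
    calc |v j| = |∑ i, v i * P i j| := by
          rw [← congrFun hv j]; rfl
      _ ≤ ∑ i, |v i * P i j| := Finset.abs_sum_le_sum_abs _ _
      _ = ∑ i, |v i| * P i j := by
          simp_rw [abs_mul, abs_of_nonneg (nonneg_of_mem_rowStochastic hP)]
  have htot : ∑ j, |v j| = ∑ j, ∑ i, |v i| * P i j := by
    rw [Finset.sum_comm]
    simp_rw [← Finset.mul_sum, sum_row_of_mem_rowStochastic hP, mul_one]
  have heq := (Finset.sum_eq_sum_iff_of_le fun j _ ↦ hle j).mp htot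
  obtain ⟨k, hk⟩ := Function.ne_iff.mp hv0
  have hpos : 0 < ∑ i, |v i| :=
    Finset.sum_pos' (fun i _ ↦ abs_nonneg _) ⟨k, Finset.mem_univ _, abs_pos.mpr hk⟩
  refine ⟨fun i ↦ |v i| / ∑ i, |v i|, fun i ↦ by positivity, ?_, ?_⟩
  · rw [← Finset.sum_div, div_self hpos.ne']
  · ext j
    simp only [Matrix.vecMul, dotProduct]
    rw [heq j (Finset.mem_univ _), Finset.sum_div]
    exact Finset.sum_congr rfl fun i _ ↦ by ring

/-! ### Growth of the open-loop covariance -/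

section Growth

variable {n : ℕ}

open scoped Matrix.Norms.Operator in
/-- Gelfand's formula, read entrywise: the entries of `A ^ k` grow at most like `r ^ k` for every
`r` above the spectral radius. -/
lemma exists_abs_pow_apply_le (A : Matrix (Fin n) (Fin n) ℝ) {r : ℝ} (hr : maxEigAbs A < r) :
    ∃ K : ℝ, ∀ k a b, |(A ^ k) a b| ≤ K * r ^ k := by
  set B : Matrix (Fin n) (Fin n) ℂ := A.map (fun r : ℝ => (r : ℂ)) with hB
  have hr0 : 0 < r := ENNReal.toReal_nonneg.trans_lt hr
  have hfin : spectralRadius ℂ B ≠ ∞ := by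
    refine ne_top_of_le_ne_top ?_ (spectrum.spectralRadius_le_pow_nnnorm_pow_one_div ℂ B 0)
    simp [ENNReal.mul_eq_top]
  have hlt : spectralRadius ℂ B < ENNReal.ofReal r := by
    rwa [← ENNReal.ofReal_toReal hfin, ENNReal.ofReal_lt_ofReal_iff hr0]
  have hev : ∀ᶠ k : ℕ in atTop, ‖B ^ k‖ ≤ r ^ k := by
    filter_upwards [eventually_lt_of_limsup_lt
      ((spectrum.limsup_pow_nnnorm_pow_one_div_le_spectralRadius B).trans_lt hlt),
      eventually_gt_atTop 0] with k hk hk0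
    have hk' : ((‖B ^ k‖₊ : ℝ≥0∞) ^ (1 / k : ℝ)) ^ k ≤ ENNReal.ofReal r ^ k := by gcongr
    rw [one_div, ENNReal.rpow_inv_natCast_pow hk0.ne' _, ← ENNReal.ofReal_pow hr0.le,
      ← enorm_eq_nnnorm, ← ofReal_norm, ENNReal.ofReal_le_ofReal_iff (by positivity)] at hk'
    exact hk'
  obtain ⟨k₀, hk₀⟩ := eventually_atTop.mp hev
  have hnorm : ∀ k, ‖B ^ k‖ ≤ (1 + ∑ l ∈ Finset.range k₀, ‖B ^ l‖ / r ^ l) * r ^ k := fun k ↦ by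
    have hs : 0 ≤ ∑ l ∈ Finset.range k₀, ‖B ^ l‖ / r ^ l :=
      Finset.sum_nonneg fun _ _ ↦ by positivity
    rcases lt_or_ge k k₀ with h | h
    · have := Finset.single_le_sum (f := fun l ↦ ‖B ^ l‖ / r ^ l) (fun _ _ ↦ by positivity)
        (Finset.mem_range.mpr h)
      rw [← div_le_iff₀ (by positivity)]
      linarith
    · have := pow_pos hr0 k
      nlinarith [hk₀ k h]
  refine ⟨_, fun k a b ↦ le_trans ?_ (hnorm k)⟩
  have hpow : B ^ k = (A ^ k).map (fun r : ℝ => (r : ℂ)) := by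
    change (Complex.ofRealHom.mapMatrix A) ^ k = Complex.ofRealHom.mapMatrix (A ^ k)
    rw [map_pow]
  have hab : |(A ^ k) a b| = ‖(B ^ k) a b‖ := by
    rw [hpow, Matrix.map_apply, Complex.norm_real, Real.norm_eq_abs]
  rw [hab, Matrix.linfty_opNorm_def]
  have h1 : ‖(B ^ k) a b‖₊ ≤ ∑ j, ‖(B ^ k) a j‖₊ :=
    Finset.single_le_sum (f := fun j ↦ ‖(B ^ k) a j‖₊) (fun _ _ ↦ zero_le) (Finset.mem_univ b)
  have h2 := h1.trans (Finset.le_sup (f := fun i ↦ ∑ j, ‖(B ^ k) i j‖₊) (Finset.mem_univ a))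
  exact_mod_cast h2

lemma exists_abs_trace_conj_le {A : Matrix (Fin n) (Fin n) ℝ} {K r : ℝ}
    (hA : ∀ k a b, |(A ^ k) a b| ≤ K * r ^ k) (X : Matrix (Fin n) (Fin n) ℝ) :
    ∃ D : ℝ, 0 ≤ D ∧ ∀ k, |(A ^ k * X * (A ^ k)ᵀ).trace| ≤ D * (r ^ 2) ^ k := by
  refine ⟨∑ _a : Fin n, ∑ c, ∑ b, K ^ 2 * |X b c|, by positivity, fun k ↦ ?_⟩
  simp only [Matrix.trace, Matrix.diag_apply, Matrix.mul_apply, Matrix.transpose_apply,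
    Finset.sum_mul]
  refine (Finset.abs_sum_le_sum_abs _ _).trans (Finset.sum_le_sum fun a _ ↦ ?_)
  refine (Finset.abs_sum_le_sum_abs _ _).trans (Finset.sum_le_sum fun c _ ↦ ?_)
  refine (Finset.abs_sum_le_sum_abs _ _).trans (Finset.sum_le_sum fun b _ ↦ ?_)
  rw [abs_mul, abs_mul]
  calc |(A ^ k) a b| * |X b c| * |(A ^ k) a c|
      = |X b c| * (|(A ^ k) a b| * |(A ^ k) a c|) := by ring
    _ ≤ |X b c| * ((K * r ^ k) * (K * r ^ k)) := by
        gcongr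
        · exact (abs_nonneg _).trans (hA k a b)
        · exact hA k a b
        · exact hA k a c
    _ = K ^ 2 * |X b c| * (r ^ 2) ^ k := by ring

lemma openLoop_iterate (A Q X : Matrix (Fin n) (Fin n) ℝ) (j : ℕ) :
    (openLoop A Q)^[j] X =
      A ^ j * X * (A ^ j)ᵀ + ∑ i ∈ Finset.range j, A ^ i * Q * (A ^ i)ᵀ := by
  induction j with
  | zero => simp
  | succ j ih =>
    rw [Function.iterate_succ_apply', ih, Finset.sum_range_succ', openLoop, Matrix.mul_add,
      Matrix.add_mul, Matrix.mul_sum, Matrix.sum_mul, add_assoc]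
    simp only [pow_succ', Matrix.transpose_mul, pow_zero, Matrix.transpose_one, Matrix.mul_assoc,
      Matrix.one_mul, Matrix.mul_one]

/-- The expected cost of the geometric waiting times is finite as soon as
`(1 - λ_e) |λ_max(A)| ^ 2 < 1`. Only the growth of `f ^ j` matters here, so the starting
covariance is arbitrary. -/
lemma summable_geometric_mul_trCov (A Q X : Matrix (Fin n) (Fin n) ℝ) {lamE : ℝ}
    (h0 : 0 < lamE) (h1 : lamE < 1)
    (h : maxEigAbs A = 0 ∨ 1 - 1 / maxEigAbs A ^ 2 < lamE) (N : ℕ) :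
    Summable fun k : ℕ ↦ lamE * (1 - lamE) ^ k * trCov A Q X (N + k) := by
  have hq : 0 < 1 - lamE := by linarith
  obtain ⟨r, hr, hr1, hrq⟩ : ∃ r : ℝ, maxEigAbs A < r ∧ 1 < r ∧ (1 - lamE) * r ^ 2 < 1 := by
    have hs0 : 0 ≤ maxEigAbs A := ENNReal.toReal_nonneg
    have hs : (1 - lamE) * (max (maxEigAbs A) 1) ^ 2 < 1 := by
      rcases max_cases (maxEigAbs A) 1 with ⟨he, hge⟩ | ⟨he, -⟩
      · rcases h with h | h
        · linarith
        · rw [he]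
          have : 1 - lamE < 1 / maxEigAbs A ^ 2 := by linarith
          rwa [lt_div_iff₀ (by positivity)] at this
      · rw [he]; linarith
    have hcont : ContinuousAt (fun r : ℝ ↦ (1 - lamE) * r ^ 2) (max (maxEigAbs A) 1) := by fun_prop
    have hev : ∀ᶠ r in 𝓝[>] (max (maxEigAbs A) 1), (1 - lamE) * r ^ 2 < 1 :=
      nhdsWithin_le_nhds (hcont.eventually_lt_const hs)
    obtain ⟨r, hr, hrm⟩ := (hev.and self_mem_nhdsWithin).exists
    exact ⟨r, (le_max_left _ _).trans_lt hrm, (le_max_right _ _).trans_lt hrm, hr⟩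
  obtain ⟨K, hA⟩ := exists_abs_pow_apply_le A hr
  obtain ⟨D, -, hD⟩ := exists_abs_trace_conj_le hA X
  obtain ⟨D', hD0', hD'⟩ := exists_abs_trace_conj_le hA Q
  have hr2 : 1 ≤ r ^ 2 := by nlinarith
  have hbound : ∀ j, |trCov A Q X j| ≤ D * (r ^ 2) ^ j + j * (D' * (r ^ 2) ^ j) := fun j ↦ by
    rw [trCov, openLoop_iterate, Matrix.trace_add, Matrix.trace_sum]
    refine (abs_add_le _ _).trans (add_le_add (hD j) ?_)
    refine (Finset.abs_sum_le_sum_abs _ _).trans ?_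
    have := Finset.sum_le_card_nsmul (Finset.range j)
      (fun i ↦ |(A ^ i * Q * (A ^ i)ᵀ).trace|) (D' * (r ^ 2) ^ j) fun i hi ↦
        (hD' i).trans (by gcongr; exact (Finset.mem_range.mp hi).le)
    simpa using this
  -- The whole series `∑ (1 - λ_e) ^ j |c j|` is dominated; the claim is about its tail from `N` on.
  have hsum : Summable fun j : ℕ ↦ (1 - lamE) ^ j * trCov A Q X j := by
    have hx0 : 0 ≤ (1 - lamE) * r ^ 2 := by positivity
    have g1 := (summable_geometric_of_lt_one hx0 hrq).mul_left D
    have g2 := (summable_pow_mul_geometric_of_norm_lt_one 1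
      (r := (1 - lamE) * r ^ 2) (by rwa [Real.norm_of_nonneg hx0])).mul_left D'
    refine Summable.of_norm_bounded (g1.add g2) fun j ↦ ?_
    rw [norm_mul, Real.norm_of_nonneg (by positivity), Real.norm_eq_abs, mul_pow, pow_one]
    calc (1 - lamE) ^ j * |trCov A Q X j|
        ≤ (1 - lamE) ^ j * (D * (r ^ 2) ^ j + j * (D' * (r ^ 2) ^ j)) := by
          gcongr; exact hbound j
      _ = _ := by ring
  have htail := ((summable_nat_add_iff N).mpr hsum).mul_left (lamE / (1 - lamE) ^ N)
  refine htail.congr fun k ↦ ?_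
  rw [pow_add, add_comm k N]
  field_simp

end Growth

lemma truncCost_lt_top {lamE : ℝ} {c : ℕ → ℝ} {N : ℕ}
    (h : Summable fun k : ℕ ↦ lamE * (1 - lamE) ^ k * c (N + k))
    (ρ : Fin (N + 1) → Fin (N + 1) → Bool → ℝ) : truncCost lamE c ρ < ∞ := by
  refine ENNReal.add_lt_top.mpr ⟨?_, ?_⟩
  · refine ENNReal.sum_lt_top.mpr fun i _ ↦ ENNReal.sum_lt_top.mpr fun j _ ↦
      ENNReal.sum_lt_top.mpr fun a _ ↦ ?_
    split_ifs
    · exact ENNReal.ofReal_lt_top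
    · exact ENNReal.zero_lt_top
  · exact ENNReal.sum_lt_top.mpr fun i _ ↦
      ENNReal.mul_lt_top ENNReal.ofReal_lt_top h.tsum_ofReal_ne_top.lt_top

/-! ### The truncated process under the modified reference policy -/

section Truncated

variable {N : ℕ}

lemma sum_sum_mul_truncProb (lam lamA lamE : ℝ) (i j : Fin (N + 1)) (a : Bool)
    (g : Fin (N + 1) → Fin (N + 1) → ℝ) :
    ∑ i', ∑ j', truncProb lam lamA lamE i j a i' j' * g i' j' =
      if a then
        (1 - lam * lamA) * (1 - lamE) * g (incr i) (incr j)
          + lam * lamA * (1 - lamE) * g 0 (incr j)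
          + (1 - lam * lamA) * lamE * g (incr i) 0
          + lam * lamA * lamE * g 0 0
      else g (incr i) (incr j) := by
  cases a <;>
    simp [truncProb, add_mul, Finset.sum_add_distrib, ite_and, ite_mul, Finset.sum_ite_eq']

lemma truncProb_nonneg {lam lamA lamE : ℝ} (h0 : 0 ≤ lam * lamA) (h1 : lam * lamA ≤ 1)
    (hE0 : 0 ≤ lamE) (hE1 : lamE ≤ 1) (i j : Fin (N + 1)) (a : Bool) (i' j' : Fin (N + 1)) :
    0 ≤ truncProb lam lamA lamE i j a i' j' := by
  have h2 : 0 ≤ 1 - lam * lamA := by linarith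
  have h3 : 0 ≤ 1 - lamE := by linarith
  unfold truncProb
  split_ifs <;> positivity

lemma sum_sum_truncProb (lam lamA lamE : ℝ) (i j : Fin (N + 1)) (a : Bool) :
    ∑ i', ∑ j', truncProb lam lamA lamE i j a i' j' = 1 := by
  have h := sum_sum_mul_truncProb lam lamA lamE i j a fun _ _ ↦ 1
  simp only [mul_one] at h
  rw [h]
  split_ifs
  · ring
  · rfl

/-- The probability of the command `a` in the state `(i, j)` under the reference policy `τ`,
modified so that it always transmits on the boundary `i = N` or `j = N`. -/
def boundaryPolicy (τ : ℕ → ℝ) (i j : Fin (N + 1)) (a : Bool) : ℝ :=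
  if i = Fin.last N ∨ j = Fin.last N then (if a then 1 else 0) else (if a then τ i else 1 - τ i)

lemma boundaryPolicy_nonneg {τ : ℕ → ℝ} (hτ : ∀ i, τ i ∈ Set.Icc (0 : ℝ) 1)
    (i j : Fin (N + 1)) (a : Bool) : 0 ≤ boundaryPolicy τ i j a := by
  have := hτ i
  unfold boundaryPolicy
  split_ifs <;> simp [this.1, this.2]

lemma sum_boundaryPolicy (τ : ℕ → ℝ) (i j : Fin (N + 1)) :
    ∑ a, boundaryPolicy τ i j a = 1 := by
  unfold boundaryPolicy
  split_ifs <;> simp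

/-- The occupation measure of the modified reference policy. -/
lemma exists_truncOccupation {lam lamA lamE : ℝ} (h0 : 0 ≤ lam * lamA) (h1 : lam * lamA ≤ 1)
    (hE0 : 0 ≤ lamE) (hE1 : lamE ≤ 1) {τ : ℕ → ℝ} (hτ : ∀ i, τ i ∈ Set.Icc (0 : ℝ) 1) (N : ℕ) :
    ∃ ρ : Fin (N + 1) → Fin (N + 1) → Bool → ℝ, IsTruncOccupation lam lamA lamE ρ ∧
      ∀ i j a, ρ i j a = (∑ b, ρ i j b) * boundaryPolicy τ i j a := by
  let P : Matrix (Fin (N + 1) × Fin (N + 1)) (Fin (N + 1) × Fin (N + 1)) ℝ := fun s t ↦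
    ∑ a, boundaryPolicy τ s.1 s.2 a * truncProb lam lamA lamE s.1 s.2 a t.1 t.2
  have hP : P ∈ rowStochastic ℝ (Fin (N + 1) × Fin (N + 1)) := by
    refine mem_rowStochastic_iff_sum.mpr ⟨fun s t ↦ Finset.sum_nonneg fun a _ ↦
      mul_nonneg (boundaryPolicy_nonneg hτ _ _ _) (truncProb_nonneg h0 h1 hE0 hE1 _ _ _ _ _),
      fun s ↦ ?_⟩
    simp only [P]
    rw [Finset.sum_comm]
    simp_rw [← Finset.mul_sum, Fintype.sum_prod_type, sum_sum_truncProb, mul_one]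
    exact sum_boundaryPolicy τ _ _
  obtain ⟨v, hv0, hv1, hv⟩ := exists_stationary_of_mem_rowStochastic hP
  have hsum : ∀ i j, ∑ a, v (i, j) * boundaryPolicy τ i j a = v (i, j) := fun i j ↦ by
    rw [← Finset.mul_sum, sum_boundaryPolicy, mul_one]
  have htot : ∑ i, ∑ j, ∑ a, v (i, j) * boundaryPolicy τ i j a = 1 := by
    simp_rw [hsum, ← hv1, Fintype.sum_prod_type]
  have hnn : ∀ i j a, 0 ≤ v (i, j) * boundaryPolicy τ i j a := fun i j a ↦
    mul_nonneg (hv0 _) (boundaryPolicy_nonneg hτ _ _ _)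
  refine ⟨fun i j a ↦ v (i, j) * boundaryPolicy τ i j a, ⟨fun i' j' ↦ ?_, htot, hnn, ?_⟩, ?_⟩
  · rw [hsum, ← congrFun hv (i', j')]
    simp only [Matrix.vecMul, dotProduct, Fintype.sum_prod_type, P, Finset.mul_sum, mul_assoc]
  · intro i j a
    rw [← htot]
    calc v (i, j) * boundaryPolicy τ i j a
        ≤ ∑ a, v (i, j) * boundaryPolicy τ i j a :=
          Finset.single_le_sum (f := fun a ↦ v (i, j) * boundaryPolicy τ i j a)
            (fun _ _ ↦ hnn _ _ _) (Finset.mem_univ a)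
      _ ≤ ∑ j, ∑ a, v (i, j) * boundaryPolicy τ i j a :=
          Finset.single_le_sum (f := fun j ↦ ∑ a, v (i, j) * boundaryPolicy τ i j a)
            (fun _ _ ↦ Finset.sum_nonneg fun _ _ ↦ hnn _ _ _) (Finset.mem_univ j)
      _ ≤ _ :=
          Finset.single_le_sum (f := fun i ↦ ∑ j, ∑ a, v (i, j) * boundaryPolicy τ i j a)
            (fun _ _ ↦ Finset.sum_nonneg fun _ _ ↦ Finset.sum_nonneg fun _ _ ↦ hnn _ _ _)
            (Finset.mem_univ i)
  · intro i j a
    rw [hsum]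

end Truncated

/-! ### Marginal laws of the two holding times -/

/-- `r i a` is the joint law of a single holding time, cut off at `N`, and the command, in a
stationary regime where a transmission resets the holding time with probability `p` and where `N`
always transmits. The balance equations are stated against all test functions `h`. -/
structure IsHoldingFlow (p : ℝ) (N : ℕ) (r : Fin (N + 1) → Bool → ℝ) : Prop where
  nonneg : ∀ i a, 0 ≤ r i a
  total : ∑ i, ∑ a, r i a = 1
  last : r (Fin.last N) false = 0
  balance : ∀ h : Fin (N + 1) → ℝ, ∑ i, (∑ a, r i a) * h i =
    ∑ i, (r i false * h (incr i) + r i true * ((1 - p) * h (incr i) + p * h 0))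

section Marginals

variable {lam lamA lamE : ℝ} {N : ℕ} {ρ : Fin (N + 1) → Fin (N + 1) → Bool → ℝ}

lemma IsTruncOccupation.sum_mul (hρ : IsTruncOccupation lam lamA lamE ρ)
    (g : Fin (N + 1) → Fin (N + 1) → ℝ) :
    ∑ i, ∑ j, (∑ a, ρ i j a) * g i j =
      ∑ i, ∑ j, ∑ a, ρ i j a *
        ∑ i', ∑ j', truncProb lam lamA lamE i j a i' j' * g i' j' := by
  simp_rw [hρ.balance, Finset.sum_mul, Finset.mul_sum, ← Fintype.sum_prod_type', ← mul_assoc]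
  exact Fintype.sum_equiv
    { toFun := fun x ↦ (x.2.2.1, x.2.2.2.1, x.2.2.2.2, x.1, x.2.1)
      invFun := fun x ↦ (x.2.2.2.1, x.2.2.2.2, x.1, x.2.1, x.2.2.1)
      left_inv := fun _ ↦ rfl
      right_inv := fun _ ↦ rfl } _ _ fun _ ↦ rfl

lemma IsTruncOccupation.isHoldingFlow_fst (hρ : IsTruncOccupation lam lamA lamE ρ)
    (hb : ∀ i j, i = Fin.last N ∨ j = Fin.last N → ρ i j false = 0) :
    IsHoldingFlow (lam * lamA) N fun i a ↦ ∑ j, ρ i j a where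
  nonneg i a := Finset.sum_nonneg fun j _ ↦ hρ.nonneg i j a
  total := by
    rw [← hρ.total]
    exact Finset.sum_congr rfl fun i _ ↦ Finset.sum_comm
  last := Finset.sum_eq_zero fun j _ ↦ hb _ _ (Or.inl rfl)
  balance h := by
    have key := hρ.sum_mul fun i _ ↦ h i
    simp_rw [sum_sum_mul_truncProb] at key
    convert key using 1
    · refine Finset.sum_congr rfl fun i _ ↦ ?_
      rw [Finset.sum_comm, Finset.sum_mul]
    · refine Finset.sum_congr rfl fun i _ ↦ ?_
      rw [Finset.sum_mul, Finset.sum_mul, ← Finset.sum_add_distrib]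
      refine Finset.sum_congr rfl fun j _ ↦ ?_
      simp only [Fintype.sum_bool, if_true, Bool.false_eq_true, if_false]
      ring

lemma IsTruncOccupation.isHoldingFlow_snd (hρ : IsTruncOccupation lam lamA lamE ρ)
    (hb : ∀ i j, i = Fin.last N ∨ j = Fin.last N → ρ i j false = 0) :
    IsHoldingFlow lamE N fun j a ↦ ∑ i, ρ i j a where
  nonneg j a := Finset.sum_nonneg fun i _ ↦ hρ.nonneg i j a
  total := by
    rw [← hρ.total, Finset.sum_comm (f := fun i j ↦ ∑ a, ρ i j a)]
    exact Finset.sum_congr rfl fun j _ ↦ Finset.sum_comm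
  last := Finset.sum_eq_zero fun i _ ↦ hb _ _ (Or.inr rfl)
  balance h := by
    have key := hρ.sum_mul fun _ j ↦ h j
    simp_rw [sum_sum_mul_truncProb] at key
    convert key using 1
    · rw [Finset.sum_comm]
      refine Finset.sum_congr rfl fun j _ ↦ ?_
      rw [Finset.sum_comm, Finset.sum_mul]
    · rw [Finset.sum_comm]
      refine Finset.sum_congr rfl fun j _ ↦ ?_
      rw [Finset.sum_mul, Finset.sum_mul, ← Finset.sum_add_distrib]
      refine Finset.sum_congr rfl fun i _ ↦ ?_
      simp only [Fintype.sum_bool, if_true, Bool.false_eq_true, if_false]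
      ring

end Marginals

namespace IsHoldingFlow

variable {p : ℝ} {N : ℕ} {r : Fin (N + 1) → Bool → ℝ}

lemma mass_nonneg (hr : IsHoldingFlow p N r) (i : Fin (N + 1)) : 0 ≤ ∑ a, r i a :=
  Finset.sum_nonneg fun a _ ↦ hr.nonneg i a

lemma total_range (hr : IsHoldingFlow p N r) :
    ∑ k ∈ Finset.range (N + 1), ∑ a, r (Fin.ofNat (N + 1) k) a = 1 := by
  rw [← hr.total, ← Fin.sum_univ_eq_sum_range]
  simp

lemma mass_succ (hr : IsHoldingFlow p N r) {k : ℕ} (hk : k + 1 < N) :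
    ∑ a, r (Fin.ofNat (N + 1) (k + 1)) a =
      r (Fin.ofNat (N + 1) k) false + (1 - p) * r (Fin.ofNat (N + 1) k) true := by
  have h := hr.balance fun i ↦ if i = Fin.ofNat (N + 1) (k + 1) then 1 else 0
  have hz : (0 : Fin (N + 1)) ≠ Fin.ofNat (N + 1) (k + 1) := by
    simp [Fin.ext_iff, Nat.mod_eq_of_lt (show k + 1 < N + 1 by omega)]
  have hi : ∀ i : Fin (N + 1), incr i = Fin.ofNat (N + 1) (k + 1) ↔ i = Fin.ofNat (N + 1) k := by
    intro i
    simp only [Fin.ext_iff, incr, Fin.val_ofNat, Nat.mod_eq_of_lt (show k + 1 < N + 1 by omega),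
      Nat.mod_eq_of_lt (show k < N + 1 by omega)]
    omega
  simp only [hz, hi, if_false, mul_zero, add_zero, mul_ite, mul_one, Finset.sum_add_distrib,
    Finset.sum_ite_eq', Finset.mem_univ, if_true] at h
  rw [h, mul_comm]

lemma mass_last (hr : IsHoldingFlow p N r) {k : ℕ} (hk : k + 1 = N) :
    p * ∑ a, r (Fin.last N) a =
      r (Fin.ofNat (N + 1) k) false + (1 - p) * r (Fin.ofNat (N + 1) k) true := by
  have h := hr.balance fun i ↦ if i = Fin.last N then 1 else 0
  have hz : (0 : Fin (N + 1)) ≠ Fin.last N := by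
    simp [Fin.ext_iff]; omega
  have hi : ∀ i : Fin (N + 1), (if incr i = Fin.last N then (1 : ℝ) else 0) =
      (if i = Fin.ofNat (N + 1) k then 1 else 0) + (if i = Fin.last N then 1 else 0) := by
    intro i
    have h1 : incr i = Fin.last N ↔ i = Fin.ofNat (N + 1) k ∨ i = Fin.last N := by
      simp only [Fin.ext_iff, incr, Fin.val_ofNat, Fin.val_last,
        Nat.mod_eq_of_lt (show k < N + 1 by omega)]
      omega
    have h2 : Fin.ofNat (N + 1) k ≠ Fin.last N := by
      simp only [ne_eq, Fin.ext_iff, Fin.val_ofNat, Fin.val_last,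
        Nat.mod_eq_of_lt (show k < N + 1 by omega)]
      omega
    by_cases ha : i = Fin.ofNat (N + 1) k
    · rw [if_pos (h1.mpr (Or.inl ha)), if_pos ha, if_neg (ha ▸ h2), add_zero]
    · rw [if_neg ha, zero_add]
      exact if_congr (h1.trans (or_iff_right ha)) rfl rfl
  simp only [hz, hi, if_false, mul_zero, add_zero, mul_ite, mul_one, mul_add,
    Finset.sum_add_distrib, Finset.sum_ite_eq', Finset.mem_univ, if_true] at h
  have hl := hr.last
  simp only [Fintype.sum_bool, hl, add_zero] at h ⊢
  linarith

/-- The mass at the cut-off is small: the masses decrease up to `N - 1`, so that the last of them is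
at most `1 / N`, and the cut-off loses the fraction `p` of its mass in each step. -/
lemma mul_mass_last_le (hr : IsHoldingFlow p N r) (hp0 : 0 ≤ p) (hN : 0 < N) :
    p * N * ∑ a, r (Fin.last N) a ≤ 1 := by
  set x : ℕ → ℝ := fun k ↦ ∑ a, r (Fin.ofNat (N + 1) k) a with hx
  have hdrop : ∀ k,
      r (Fin.ofNat (N + 1) k) false + (1 - p) * r (Fin.ofNat (N + 1) k) true ≤ x k := by
    intro k
    have := mul_nonneg hp0 (hr.nonneg (Fin.ofNat (N + 1) k) true)
    simp only [hx, Fintype.sum_bool]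
    linarith
  have hanti : ∀ l k, k + l < N → x (k + l) ≤ x k := by
    intro l
    induction l with
    | zero => intro k _; exact le_rfl
    | succ l ih =>
      intro k hkl
      exact ((hr.mass_succ (k := k + l) (by omega)).le.trans (hdrop _)).trans (ih k (by omega))
  have hlast : p * ∑ a, r (Fin.last N) a ≤ x (N - 1) :=
    (hr.mass_last (k := N - 1) (by omega)).le.trans (hdrop _)
  have hsum : N * x (N - 1) ≤ ∑ k ∈ Finset.range N, x k := by
    have := Finset.card_nsmul_le_sum (Finset.range N) x (x (N - 1)) fun k hk ↦ by
      have hk' := Finset.mem_range.mp hk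
      have := hanti (N - 1 - k) k (by omega)
      rwa [show k + (N - 1 - k) = N - 1 by omega] at this
    simpa using this
  have htot := hr.total_range
  rw [Finset.sum_range_succ] at htot
  have hx0 := hr.mass_nonneg (Fin.ofNat (N + 1) N)
  calc p * N * ∑ a, r (Fin.last N) a = N * (p * ∑ a, r (Fin.last N) a) := by ring
    _ ≤ N * x (N - 1) := by gcongr
    _ ≤ 1 := by linarith

end IsHoldingFlow

/-! ### Comparison with the stationary law of the reference policy -/

section Sensor

variable {lam lamA : ℝ} {τ π : ℕ → ℝ}

lemma IsSensorStationary.succ (hπ : IsSensorStationary lam lamA τ π) (i : ℕ) :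
    π (i + 1) = (1 - lam * lamA * τ i) * π i := by
  have h := hasSum_single (f := fun k ↦ π k * sensorProb lam lamA τ k (i + 1)) i fun k hk ↦ by
    simp [sensorProb, hk.symm]
  rw [(hπ.balance (i + 1)).unique h]
  simp only [sensorProb, if_true]
  ring

lemma IsSensorStationary.zero_pos (hπ : IsSensorStationary lam lamA τ π) : 0 < π 0 := by
  refine (hπ.nonneg 0).lt_of_ne fun h0 ↦ ?_
  have hz : ∀ i, π i = 0 := by
    intro i
    induction i with
    | zero => exact h0.symm
    | succ i ih => rw [hπ.succ, ih, mul_zero]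
  have h := hπ.total
  rw [funext hz] at h
  exact zero_ne_one (hasSum_zero.unique h)

/-- Without resets the sensor's holding time would escape to infinity. -/
lemma IsSensorStationary.reset_ne_zero (hπ : IsSensorStationary lam lamA τ π) :
    lam * lamA ≠ 0 := by
  intro h
  have h0 := hπ.balance 0
  have : (fun i ↦ π i * sensorProb lam lamA τ i 0) = fun _ ↦ 0 := by
    funext i
    simp [sensorProb, mul_assoc, h]
  rw [this] at h0
  exact hπ.zero_pos.ne (hasSum_zero.unique h0)

end Sensor

section Comparison

variable {p : ℝ} {τ π m b : ℕ → ℝ} {N : ℕ}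

/-- The defect of `m` against the multiple of `π` with the same mass at `0` is nonnegative and
accumulates only the boundary masses `b`. -/
lemma defect_bounds (hp0 : 0 ≤ p) (hp1 : p ≤ 1) (hτ : ∀ i, τ i ∈ Set.Icc (0 : ℝ) 1)
    (hπ0 : 0 < π 0) (hπs : ∀ i, π (i + 1) = (1 - p * τ i) * π i) (hb : ∀ k, 0 ≤ b k)
    (hm : ∀ k, k + 1 < N → m (k + 1) = (1 - p * τ k) * m k - p * (1 - τ k) * b k) :
    ∀ k, k < N → 0 ≤ m 0 / π 0 * π k - m k ∧
      m 0 / π 0 * π k - m k ≤ ∑ l ∈ Finset.range k, b l := by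
  intro k
  induction k with
  | zero => intro _; simp [hπ0.ne']
  | succ k ih =>
    intro hk
    obtain ⟨h1, h2⟩ := ih (by omega)
    have hτ0 := (hτ k).1
    have hτ1 := (hτ k).2
    have hpτ0 : 0 ≤ p * τ k := mul_nonneg hp0 hτ0
    have hpτ1 : p * τ k ≤ 1 := mul_le_one₀ hp1 hτ0 hτ1
    have hc0 : 0 ≤ p * (1 - τ k) := mul_nonneg hp0 (by linarith)
    have hc1 : p * (1 - τ k) ≤ 1 := by linarith [mul_sub p 1 (τ k)]
    have heq : m 0 / π 0 * π (k + 1) - m (k + 1) =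
        (1 - p * τ k) * (m 0 / π 0 * π k - m k) + p * (1 - τ k) * b k := by
      rw [hm k hk, hπs k]; ring
    rw [heq, Finset.sum_range_succ]
    refine ⟨add_nonneg (mul_nonneg (by linarith) h1) (mul_nonneg hc0 (hb k)), ?_⟩
    refine add_le_add (le_trans ?_ h2) (mul_le_of_le_one_left (hb k) hc1)
    exact mul_le_of_le_one_left h1 (by linarith)

/-- The `ℓ¹` distance of `m` and `π` below the cut-off. The bound on the normalizing factor
`m 0 / π 0` from above comes from comparing the masses below an auxiliary level `K`. -/
lemma sum_abs_sub_le {K : ℕ} {δ : ℝ} (hp0 : 0 ≤ p) (hp1 : p ≤ 1)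
    (hτ : ∀ i, τ i ∈ Set.Icc (0 : ℝ) 1) (hπnn : ∀ i, 0 ≤ π i) (hπ1 : HasSum π 1)
    (hπ0 : 0 < π 0) (hπs : ∀ i, π (i + 1) = (1 - p * τ i) * π i)
    (hb : ∀ k, 0 ≤ b k) (hbδ : ∑ k ∈ Finset.range N, b k ≤ δ)
    (hm0 : ∀ k, 0 ≤ m k) (hm1 : ∑ k ∈ Finset.range (N + 1), m k = 1)
    (hm : ∀ k, k + 1 < N → m (k + 1) = (1 - p * τ k) * m k - p * (1 - τ k) * b k)
    (hK0 : 0 < K) (hKN : K ≤ N) :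
    ∑ k ∈ Finset.range N, |m k - π k| ≤
      2 * ((1 + K * δ) / (∑ k ∈ Finset.range K, π k) - 1) + 3 * m N := by
  set θ := m 0 / π 0
  have hd := defect_bounds hp0 hp1 hτ hπ0 hπs hb hm
  have hS : ∀ n, ∑ k ∈ Finset.range n, π k ≤ 1 := fun n ↦
    sum_le_hasSum _ (fun i _ ↦ hπnn i) hπ1
  have hSK : 0 < ∑ k ∈ Finset.range K, π k :=
    Finset.sum_pos' (fun i _ ↦ hπnn i) ⟨0, Finset.mem_range.mpr hK0, hπ0⟩
  have hθ0 : 0 ≤ θ := div_nonneg (hm0 0) hπ0.le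
  rw [Finset.sum_range_succ] at hm1
  have hsumd : ∑ k ∈ Finset.range N, (θ * π k - m k) =
      θ * ∑ k ∈ Finset.range N, π k - (1 - m N) := by
    rw [Finset.sum_sub_distrib, ← Finset.mul_sum]; linarith
  have hθN : θ * ∑ k ∈ Finset.range N, π k ≤ θ := mul_le_of_le_one_right hθ0 (hS N)
  have hlow : 1 - m N ≤ θ := by
    have : 0 ≤ ∑ k ∈ Finset.range N, (θ * π k - m k) :=
      Finset.sum_nonneg fun k hk ↦ (hd k (Finset.mem_range.mp hk)).1
    linarith
  have hup : θ ≤ (1 + K * δ) / ∑ k ∈ Finset.range K, π k := by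
    rw [le_div_iff₀ hSK]
    have h1 : ∑ k ∈ Finset.range K, (θ * π k - m k) ≤ K * δ := by
      have := Finset.sum_le_card_nsmul (Finset.range K) (fun k ↦ θ * π k - m k) δ fun k hk ↦ by
        have hk' : k < N := (Finset.mem_range.mp hk).trans_le hKN
        refine ((hd k hk').2.trans ?_).trans hbδ
        exact Finset.sum_le_sum_of_subset_of_nonneg (Finset.range_mono hk'.le) fun i _ _ ↦ hb i
      simpa using this
    rw [Finset.sum_sub_distrib, ← Finset.mul_sum] at h1
    have h2 : ∑ k ∈ Finset.range K, m k ≤ ∑ k ∈ Finset.range N, m k :=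
      Finset.sum_le_sum_of_subset_of_nonneg (Finset.range_mono hKN) fun i _ _ ↦ hm0 i
    linarith [hm0 N]
  have hδ : 0 ≤ δ := (Finset.sum_nonneg fun k _ ↦ hb k).trans hbδ
  have hge : 1 ≤ (1 + K * δ) / ∑ k ∈ Finset.range K, π k := by
    rw [le_div_iff₀ hSK]
    have : 0 ≤ K * δ := by positivity
    linarith [hS K]
  have habs : |θ - 1| ≤ (1 + K * δ) / (∑ k ∈ Finset.range K, π k) - 1 + m N := by
    rw [abs_le]
    constructor <;> linarith [hm0 N]
  have hterm : ∀ k ∈ Finset.range N, |m k - π k| ≤ (θ * π k - m k) + |θ - 1| * π k := by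
    intro k hk
    have h1 := (hd k (Finset.mem_range.mp hk)).1
    calc |m k - π k| = |(θ - 1) * π k - (θ * π k - m k)| := by congr 1; ring
      _ ≤ |(θ - 1) * π k| + |θ * π k - m k| := abs_sub _ _
      _ = _ := by rw [abs_mul, abs_of_nonneg (hπnn k), abs_of_nonneg h1, add_comm]
  have hsum := Finset.sum_le_sum hterm
  rw [Finset.sum_add_distrib, hsumd, ← Finset.mul_sum] at hsum
  have : |θ - 1| * ∑ k ∈ Finset.range N, π k ≤ |θ - 1| :=
    mul_le_of_le_one_right (abs_nonneg _) (hS N)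
  linarith [hm0 N]

end Comparison

/-! ### Stealthiness of the modified reference policy -/

section Stealth

variable {lam lamA lamE : ℝ} {τ π : ℕ → ℝ}

lemma tsum_tail (hπ : IsSensorStationary lam lamA τ π) (N : ℕ) :
    ∑' k, π (N + k) = 1 - ∑ k ∈ Finset.range N, π k := by
  have h := hπ.total.summable.sum_add_tsum_nat_add N
  rw [hπ.total.tsum_eq] at h
  simp_rw [add_comm N]
  linarith

lemma summable_omegaS (hτ : ∀ i, τ i ∈ Set.Icc (0 : ℝ) 1)
    (hπ : IsSensorStationary lam lamA τ π) (a : Bool) : Summable fun i ↦ omegaS τ π i a := by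
  refine Summable.of_nonneg_of_le (fun i ↦ ?_) (fun i ↦ ?_) hπ.total.summable <;>
  · have h1 := mul_nonneg (hπ.nonneg i) (hτ i).1
    have h2 := mul_nonneg (hπ.nonneg i) (sub_nonneg.mpr (hτ i).2)
    cases a <;> simp only [omegaS, if_true, Bool.false_eq_true, if_false] <;> linarith

lemma sum_tsum_omegaS_tail (hτ : ∀ i, τ i ∈ Set.Icc (0 : ℝ) 1)
    (hπ : IsSensorStationary lam lamA τ π) (N : ℕ) :
    (∑' k, omegaS τ π (N + k) true) + ∑' k, omegaS τ π (N + k) false =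
      1 - ∑ k ∈ Finset.range N, π k := by
  have hs : ∀ a, Summable fun k ↦ omegaS τ π (N + k) a := fun a ↦ by
    simpa only [add_comm N] using (summable_nat_add_iff N).mpr (summable_omegaS hτ hπ a)
  rw [← tsum_tail hπ N, ← (hs true).tsum_add (hs false)]
  refine tsum_congr fun k ↦ ?_
  simp only [omegaS, if_true, Bool.false_eq_true, if_false]
  ring

/-- The deviation of the sensor's state-action law under `ρ` from the stationary law `ω_s`; the
least `ε` that satisfies the stealthiness constraints. -/
noncomputable def stealthDeviation (τ π : ℕ → ℝ) {N : ℕ}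
    (ρ : Fin (N + 1) → Fin (N + 1) → Bool → ℝ) (i : Fin (N + 1)) (a : Bool) : ℝ :=
  if (i : ℕ) < N then |(∑ j, ρ i j a) - omegaS τ π i a|
  else |(∑ j, ρ i j a) - ∑' k, omegaS τ π (N + k) a|

lemma satisfiesConstraints_stealthDeviation {N : ℕ} {ρ : Fin (N + 1) → Fin (N + 1) → Bool → ℝ}
    {epsS : ℝ} (hρ : IsTruncOccupation lam lamA lamE ρ)
    (hb : ∀ i j, i = Fin.last N ∨ j = Fin.last N → ρ i j false = 0)
    (htol : ∑ i, ∑ a, stealthDeviation τ π ρ i a ≤ epsS) :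
    SatisfiesConstraints lam lamA lamE (omegaS τ π) epsS ρ (stealthDeviation τ π ρ) where
  occupation := hρ
  boundary := hb
  stealth_lower i a hi := by rw [stealthDeviation, if_pos hi]; exact neg_abs_le _
  stealth_upper i a hi := by rw [stealthDeviation, if_pos hi]; exact le_abs_self _
  stealth_last_lower a := by rw [stealthDeviation, if_neg (by simp)]; exact neg_abs_le _
  stealth_last_upper a := by rw [stealthDeviation, if_neg (by simp)]; exact le_abs_self _
  tolerance := htol

/-- The total deviation of the modified reference policy, in terms of the horizon `N` and an
auxiliary level `K`. The terms `1 / (λ λ_a N)` and `1 / (λ_e N)` bound the masses at `i = N` and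
`j = N`. -/
lemma sum_stealthDeviation_le {N K : ℕ} {ρ : Fin (N + 1) → Fin (N + 1) → Bool → ℝ}
    (hp0 : 0 < lam * lamA) (hp1 : lam * lamA ≤ 1) (hE0 : 0 < lamE)
    (hτ : ∀ i, τ i ∈ Set.Icc (0 : ℝ) 1) (hπ : IsSensorStationary lam lamA τ π)
    (hρ : IsTruncOccupation lam lamA lamE ρ)
    (hpol : ∀ i j a, ρ i j a = (∑ b, ρ i j b) * boundaryPolicy τ i j a)
    (hK0 : 0 < K) (hKN : K ≤ N) :
    ∑ i, ∑ a, stealthDeviation τ π ρ i a ≤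
      2 * ((1 + K * (1 / (lamE * N))) / (∑ k ∈ Finset.range K, π k) - 1)
        + 4 * (1 / (lam * lamA * N)) + 2 * (1 / (lamE * N))
        + (1 - ∑ k ∈ Finset.range N, π k) := by
  have hN : 0 < N := hK0.trans_le hKN
  have hN' : (0 : ℝ) < N := Nat.cast_pos.mpr hN
  have hb : ∀ i j, i = Fin.last N ∨ j = Fin.last N → ρ i j false = 0 := fun i j h ↦ by
    rw [hpol, boundaryPolicy, if_pos h]; simp
  have hfst := hρ.isHoldingFlow_fst hb
  have hsnd := hρ.isHoldingFlow_snd hb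
  -- `m` is the law of the sensor's holding time, `b k` its part on the boundary `j = N`.
  set r : Fin (N + 1) → Bool → ℝ := fun i a ↦ ∑ j, ρ i j a with hr
  set b' : Fin (N + 1) → ℝ := fun i ↦ ρ i (Fin.last N) true with hb'
  set m : ℕ → ℝ := fun k ↦ ∑ a, r (Fin.ofNat (N + 1) k) a with hm
  set b : ℕ → ℝ := fun k ↦ b' (Fin.ofNat (N + 1) k) with hbdef
  have hlastN : Fin.ofNat (N + 1) N = Fin.last N := by simp
  have hmN : m N ≤ 1 / (lam * lamA * N) := by
    rw [le_div_iff₀ (by positivity), mul_comm]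
    simp only [hm, hlastN]
    exact hfst.mul_mass_last_le hp0.le hN
  have hbN : ∑ i, b' i ≤ 1 / (lamE * N) := by
    rw [le_div_iff₀ (by positivity), mul_comm]
    have h := hsnd.mul_mass_last_le hE0.le hN
    rw [Fintype.sum_bool, hsnd.last, add_zero] at h
    exact h
  have hb0 : ∀ i, 0 ≤ b' i := fun i ↦ hρ.nonneg _ _ _
  have hrtrue : ∀ i : Fin (N + 1), (i : ℕ) < N →
      r i true = τ i * (∑ a, r i a) + (1 - τ i) * b' i := by
    intro i hi
    have hne : i ≠ Fin.last N := by
      simp [Fin.ext_iff]; omega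
    have hterm : ∀ j, ρ i j true =
        τ i * ∑ a, ρ i j a + if j = Fin.last N then (1 - τ i) * b' i else 0 := by
      intro j
      by_cases hj : j = Fin.last N
      · subst hj
        rw [if_pos rfl, Fintype.sum_bool, hb i _ (Or.inr rfl)]
        ring
      · rw [if_neg hj, add_zero, hpol i j true, boundaryPolicy, if_neg (by tauto), if_pos rfl,
          mul_comm]
    simp only [hr]
    rw [Finset.sum_congr rfl fun j _ ↦ hterm j, Finset.sum_add_distrib, ← Finset.mul_sum,
      Finset.sum_comm, Finset.sum_ite_eq' Finset.univ, if_pos (Finset.mem_univ _)]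
  have hval : ∀ k, k < N → ((Fin.ofNat (N + 1) k : Fin (N + 1)) : ℕ) = k := fun k hk ↦ by
    simp [Nat.mod_eq_of_lt (show k < N + 1 by omega)]
  have hmsucc : ∀ k, k + 1 < N → m (k + 1) =
      (1 - lam * lamA * τ k) * m k - lam * lamA * (1 - τ k) * b k := by
    intro k hk
    have h1 := hfst.mass_succ hk
    have h2 := hrtrue (Fin.ofNat (N + 1) k) (by rw [hval k (by omega)]; omega)
    rw [hval k (by omega)] at h2
    have h3 : m k = r (Fin.ofNat (N + 1) k) true + r (Fin.ofNat (N + 1) k) false :=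
      Fintype.sum_bool _
    change m (k + 1) = _ at h1
    change _ = τ k * m k + (1 - τ k) * b k at h2
    rw [h1]
    linear_combination (-(lam * lamA)) * h2 - h3
  have hbsum : ∑ k ∈ Finset.range N, b k ≤ 1 / (lamE * N) := by
    refine le_trans ?_ hbN
    have h : ∑ k ∈ Finset.range (N + 1), b k = ∑ i, b' i := by
      rw [← Fin.sum_univ_eq_sum_range]; simp [hbdef]
    rw [← h, Finset.sum_range_succ]
    linarith [hb0 (Fin.ofNat (N + 1) N)]
  have hmain := sum_abs_sub_le hp0.le hp1 hτ hπ.nonneg hπ.total hπ.zero_pos hπ.succ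
    (fun k ↦ hb0 _) hbsum (fun k ↦ hfst.mass_nonneg _) hfst.total_range hmsucc hK0 hKN
  change ∑ k ∈ Finset.range N, |m k - π k| ≤ _ + 3 * m N at hmain
  have hdev : ∀ k, k < N → ∑ a, stealthDeviation τ π ρ (Fin.ofNat (N + 1) k) a ≤
      |m k - π k| + 2 * b k := by
    intro k hk
    have hv := hval k hk
    have h2 := hrtrue (Fin.ofNat (N + 1) k) (by rw [hv]; exact hk)
    rw [hv] at h2
    have h3 : m k = r (Fin.ofNat (N + 1) k) true + r (Fin.ofNat (N + 1) k) false :=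
      Fintype.sum_bool _
    change _ = τ k * m k + (1 - τ k) * b k at h2
    have hτ0 := (hτ k).1
    have hτ1 : 0 ≤ 1 - τ k := sub_nonneg.mpr (hτ k).2
    have hbk : 0 ≤ (1 - τ k) * b k := mul_nonneg hτ1 (hb0 _)
    have hbk' : (1 - τ k) * b k ≤ b k := mul_le_of_le_one_left (hb0 _) (by linarith)
    rw [Fintype.sum_bool, stealthDeviation, stealthDeviation, hv, if_pos hk, if_pos hk]
    change |r (Fin.ofNat (N + 1) k) true - π k * τ k| +
      |r (Fin.ofNat (N + 1) k) false - π k * (1 - τ k)| ≤ _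
    have e1 : r (Fin.ofNat (N + 1) k) true - π k * τ k =
        τ k * (m k - π k) + (1 - τ k) * b k := by rw [h2]; ring
    have e2 : r (Fin.ofNat (N + 1) k) false - π k * (1 - τ k) =
        (1 - τ k) * (m k - π k) - (1 - τ k) * b k := by linear_combination -h2 - h3
    have a1 := abs_add_le (τ k * (m k - π k)) ((1 - τ k) * b k)
    have a2 := abs_sub ((1 - τ k) * (m k - π k)) ((1 - τ k) * b k)
    rw [abs_mul, abs_of_nonneg hτ0, abs_of_nonneg hbk] at a1
    rw [abs_mul, abs_of_nonneg hτ1, abs_of_nonneg hbk] at a2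
    rw [e1, e2]
    linarith
  have hdevN : ∑ a, stealthDeviation τ π ρ (Fin.last N) a ≤
      m N + (1 - ∑ k ∈ Finset.range N, π k) := by
    have h3 : m N = r (Fin.last N) true := by
      simp only [hm, hlastN, Fintype.sum_bool]
      rw [hfst.last, add_zero]
    have ht : ∀ a, 0 ≤ ∑' k, omegaS τ π (N + k) a := fun a ↦ tsum_nonneg fun k ↦ by
      have h1 := mul_nonneg (hπ.nonneg (N + k)) (hτ (N + k)).1
      have h2 := mul_nonneg (hπ.nonneg (N + k)) (sub_nonneg.mpr (hτ (N + k)).2)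
      cases a <;> simpa [omegaS]
    rw [Fintype.sum_bool, stealthDeviation, stealthDeviation, if_neg (by simp), if_neg (by simp),
      ← sum_tsum_omegaS_tail hτ hπ N]
    change |r (Fin.last N) true - _| + |r (Fin.last N) false - _| ≤ _
    rw [← h3, hfst.last, zero_sub, abs_neg, abs_of_nonneg (ht false)]
    have := abs_sub (m N) (∑' k, omegaS τ π (N + k) true)
    rw [abs_of_nonneg (ht true), abs_of_nonneg (hfst.mass_nonneg _)] at this
    linarith
  have hsplit : ∑ i, ∑ a, stealthDeviation τ π ρ i a =
      (∑ k ∈ Finset.range N, ∑ a, stealthDeviation τ π ρ (Fin.ofNat (N + 1) k) a) +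
        ∑ a, stealthDeviation τ π ρ (Fin.last N) a := by
    rw [← hlastN, ← Finset.sum_range_succ
      (fun k ↦ ∑ a, stealthDeviation τ π ρ (Fin.ofNat (N + 1) k) a), ← Fin.sum_univ_eq_sum_range]
    simp
  have hsum := Finset.sum_le_sum fun k hk ↦ hdev k (Finset.mem_range.mp hk)
  rw [Finset.sum_add_distrib, ← Finset.mul_sum] at hsum
  rw [hsplit]
  linarith

/-- With `N = K ^ 2` the auxiliary level grows, while the boundary mass of order `1 / N` stays
negligible even after multiplication by `K`. -/
lemma tendsto_deviation_bound (hπ : IsSensorStationary lam lamA τ π) (p e : ℝ) :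
    Tendsto (fun K : ℕ ↦
      2 * ((1 + K * (1 / (e * (K ^ 2 : ℕ)))) / (∑ k ∈ Finset.range K, π k) - 1)
        + 4 * (1 / (p * (K ^ 2 : ℕ))) + 2 * (1 / (e * (K ^ 2 : ℕ)))
        + (1 - ∑ k ∈ Finset.range (K ^ 2), π k)) atTop (𝓝 0) := by
  have hS := hπ.total.tendsto_sum_nat
  have hsq : Tendsto (fun K : ℕ ↦ K ^ 2) atTop atTop := tendsto_pow_atTop two_ne_zero
  have hinv : Tendsto (fun K : ℕ ↦ (K : ℝ)⁻¹) atTop (𝓝 0) := tendsto_inv_atTop_nhds_zero_nat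
  have hinv2 : ∀ c : ℝ, Tendsto (fun K : ℕ ↦ 1 / (c * (K ^ 2 : ℕ))) atTop (𝓝 0) := fun c ↦ by
    have := (hinv.comp hsq).const_mul c⁻¹
    rw [mul_zero] at this
    exact this.congr fun K ↦ by simp [mul_comm]
  have hK : Tendsto (fun K : ℕ ↦ K * (1 / (e * (K ^ 2 : ℕ)))) atTop (𝓝 0) := by
    have := hinv.const_mul e⁻¹
    rw [mul_zero] at this
    refine this.congr fun K ↦ ?_
    rcases eq_or_ne (K : ℝ) 0 with h | h
    · simp [h]
    · rw [Nat.cast_pow, one_div, mul_inv]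
      field_simp
  have h1 := ((hK.const_add 1).div hS one_ne_zero).sub_const 1 |>.const_mul 2
  have := ((h1.add ((hinv2 p).const_mul 4)).add ((hinv2 e).const_mul 2)).add
    ((hS.comp hsq).const_sub 1)
  simpa using this

end Stealth

end StealthyHacking

theorem mainTheorem2 {n p : ℕ}
    (A : Matrix (Fin n) (Fin n) ℝ) (C : Matrix (Fin p) (Fin n) ℝ)
    (Q : Matrix (Fin n) (Fin n) ℝ) (R : Matrix (Fin p) (Fin p) ℝ)
    (S₀ : Matrix (Fin n) (Fin n) ℝ)
    (hQ : Q.PosSemidef) (hR : R.PosDef) (hS₀ : S₀.PosSemidef)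
    (hobs : StealthyHacking.IsObservable C A)
    (hctrl : StealthyHacking.IsControllable A (StealthyHacking.psdSqrt Q))
    (lam lamA lamE : ℝ)
    (hlam : lam ∈ Set.Icc (0 : ℝ) 1)
    (hlamA0 : 0 ≤ lamA) (hlamA1 : lamA < 1)
    (hlamE0 : 0 < lamE) (hlamE1 : lamE < 1)
    (hlamE : StealthyHacking.maxEigAbs A = 0 ∨
      1 - 1 / StealthyHacking.maxEigAbs A ^ 2 < lamE)
    (τ : ℕ → ℝ) (hτ : ∀ i, τ i ∈ Set.Icc (0 : ℝ) 1)
    (π : ℕ → ℝ) (hπ : StealthyHacking.IsSensorStationary lam lamA τ π) :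
    ∀ epsS : ℝ, 0 < epsS → ∃ N : ℕ,
      StealthyHacking.IsFeasible lam lamA lamE
        (StealthyHacking.omegaS τ π)
        (StealthyHacking.trCov A Q (StealthyHacking.steadyCov A C Q R S₀)) N epsS := by

  intro epsS heps
  have hp0 : 0 < lam * lamA := (mul_nonneg hlam.1 hlamA0).lt_of_ne' hπ.reset_ne_zero
  have hp1 : lam * lamA ≤ 1 := mul_le_one₀ hlam.2 hlamA0 hlamA1.le
  obtain ⟨K, hK, hK0⟩ := (((StealthyHacking.tendsto_deviation_bound hπ (lam * lamA)
    lamE).eventually_lt_const heps).and (eventually_gt_atTop 0)).exists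
  obtain ⟨ρ, hρ, hpol⟩ :=
    StealthyHacking.exists_truncOccupation hp0.le hp1 hlamE0.le hlamE1.le hτ (K ^ 2)
  refine ⟨K ^ 2, ρ, StealthyHacking.stealthDeviation τ π ρ,
    StealthyHacking.satisfiesConstraints_stealthDeviation hρ (fun i j h ↦ ?_) ?_,
    StealthyHacking.truncCost_lt_top
      (StealthyHacking.summable_geometric_mul_trCov A Q _ hlamE0 hlamE1 hlamE _) ρ⟩
  · rw [hpol, StealthyHacking.boundaryPolicy, if_pos h]
    simp
  · exact (StealthyHacking.sum_stealthDeviation_le hp0 hp1 hlamE0 hτ hπ hρ hpol hK0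
      (Nat.le_self_pow two_ne_zero K)).trans hK.le
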